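/- All groups are finite. Write $x^g=g^{-1}xg$, and for a character $\psi$ of a subgroup $B\le G$ let $\psi^g$ be the character $x\mapsto\psi(gxg^{-1})$ of $g^{-1}Bg$, and $\psi^G$ the induced character; $\ker\chi=\{g:\chi(g)=\chi(1)\}$. A linear character of $B$ is a homomorphism $B\to\mathbb C^\times$. **The class $\mathcal C$.** $\mathcal C$ is the class of all finite groups $G$ such that every subgroup of $G$ and every quotient group of $G$ is abelian or contains a non-central abelian normal subgroup. **Strong Shoda pairs.** For $K\unlhd H\le G$ put $\widehat H=\frac1{|H|}\sum_{h\in H}h\in\mathbb QG$, and let $\varepsilon(H,K)=\widehat K$ if $H=K$, and $\varepsilon(H,K)=\prod_L(\widehat K-\widehat L)$ otherwise, where $L$ runs over the subgroups that are minimal among the normal subgroups of $H$ containing $K$ properly. A pair $(H,K)$ of subgroups of $G$ is a strong Shoda pair of $G$ if (i) $K\unlhd H\unlhd N_G(K)$; (ii) $H/K$ is cyclic and a maximal abelian subgroup of $N_G(K)/K$; (iii) the distinct $G$-conjugates of $\varepsilon(H,K)$ are mutually orthogonal. **Linear character triples.** Let $N\unlhd G$. An $N$-linear character triple of $G$ is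 a triple $(H,A,\vartheta)$ with $A\unlhd H\le G$ and $\vartheta$ a linear character of $A$ that is invariant in $H$ and satisfies $\ker\vartheta^G=N$. For each such triple fix a subgroup $\mathcal A=\mathcal A_{(H,A,\vartheta)}$ of maximal order among the normal subgroups of $H$ that contain $\ker\vartheta$ and are abelian modulo $\ker\vartheta$. Let $\widetilde{\mathrm{Lin}}(\mathcal A|\vartheta)$ be the set of linear characters $\varphi$ of $\mathcal A$ that lie above $\vartheta$ (that is, $A\le\mathcal A$ and $\varphi|_A=\vartheta$) with $\ker\varphi^G=N$. The group of field automorphisms of $\mathbb C$ fixing $\mathbb Q(\vartheta)$ (acting by $\varphi\mapsto\sigma\circ\varphi$) and the group $H$ (acting by $\varphi\mapsto\varphi^h$) act compatibly on this set; fix a set $\mathfrak{Lin}(\mathcal A|\vartheta)$ of representatives of the distinct orbits under the joint action. The set $Cl(H,A,\vartheta)$ of direct Clifford correspondents of $(H,A,\vartheta)$ is empty if $H=A$, and otherwise is $\{(I_H(\varphi),\mathcal A,\varphi):\varphi\in\mathfrak{Lin}(\mathcal A|\vartheta)\}$, where $I_H(\varphi)=\{g\in H:\varphi^g=\varphi\}$.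 **The graph $\mathcal G_N$.** Consider the directed graph whose vertices are the $N$-linear character triples of $G$, with an edge from $u$ to $v$ if $v\in Cl(u)$. Let $\mathcal G_N$ be its full subgraph on the vertices that can be reached by a directed path (with distinct vertices) from $(G,N,1_N)$. Let $\mathcal L_N$ be the set of leaves (vertices of out-degree $0$) of $\mathcal G_N$ of the form $(H,H,\vartheta)$. If $v_1,\dots,v_n$ are the successive vertices of the directed path from $v_1=(G,N,1_N)$ to $v_n=(H,H,\vartheta)$, then $n$ is the height and $v_i$ the $i$-th node of $(H,H,\vartheta)$. **Corollary.** Let $G\in\mathcal C$, let $N$ be a normal subgroup of $G$, let $\mathcal A_{(\cdot)}$ and $\mathfrak{Lin}$ be any fixed choices as above, and let $(H,H,\vartheta)\in\mathcal L_N$. 1. If $(H,H,\vartheta)$ has a second node $(H_2,A_2,\vartheta_2)$ and $H\unlhd N_G(\ker\vartheta_2)$, then $(H,\ker\vartheta)$ is a strong Shoda pair of $G$. 2. If $(H,H,\vartheta)$ has height $2$, then $(H,\ker\vartheta)$ is a strong Shoda pair of $G$. -/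

import Mathlib

namespace ShodaTriples

/-- A group is abelian, or it contains a non-central abelian normal subgroup. -/
def AbelianOrNoncentral (Q : Type*) [Group Q] : Prop :=
  (∀ a b : Q, a * b = b * a) ∨
    ∃ A : Subgroup Q, A.Normal ∧ IsMulCommutative A ∧ ¬ A ≤ Subgroup.center Q

/-- The class `𝒞`: all subgroups and all quotient groups of `G` are abelian or contain a
non-central abelian normal subgroup. -/
def InClassC (G : Type*) [Group G] : Prop :=
  (∀ H : Subgroup G, AbelianOrNoncentral H) ∧
    ∀ (N : Subgroup G) [N.Normal], AbelianOrNoncentral (G ⧸ N)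

/-- `H ⊴ L` for subgroups `H`, `L` of `G`. -/
def NormalIn {G : Type*} [Group G] (H L : Subgroup G) : Prop :=
  H ≤ L ∧ (H.subgroupOf L).Normal

/-- `K ⊴ B` and the quotient group `B / K` is abelian. -/
def AbelianQuotient {G : Type*} [Group G] (B K : Subgroup G) : Prop :=
  K ≤ B ∧ ∃ _ : (K.subgroupOf B).Normal, ∀ a b : B ⧸ K.subgroupOf B, a * b = b * a

section Idempotents

variable {G : Type*} [Group G] [Fintype G]

open Classical in
/-- `Ĥ = |H|⁻¹ ∑_{h ∈ H} h` in the rational group algebra `ℚG`. -/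
noncomputable def hat (H : Subgroup G) : MonoidAlgebra ℚ G :=
  (Nat.card H : ℚ)⁻¹ • ∑ h : G with h ∈ H, MonoidAlgebra.of ℚ G h

theorem commute_of_hat {L : Subgroup G} {x : G}
    (hx : x ∈ Subgroup.normalizer (L : Set G)) :
    Commute (MonoidAlgebra.of ℚ G x) (hat L) := by
  classical
  unfold hat
  refine Commute.smul_right ?_ _
  rw [commute_iff_eq, Finset.mul_sum, Finset.sum_mul]
  refine Finset.sum_bij (fun h _ => x * h * x⁻¹) ?_ ?_ ?_ ?_
  · intro h hh
    simp only [Finset.mem_filter, Finset.mem_univ, true_and] at hh ⊢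
    exact (Subgroup.mem_normalizer_iff.1 hx h).1 hh
  · intro a _ b _ hab
    simpa using hab
  · intro b hb
    simp only [Finset.mem_filter, Finset.mem_univ, true_and] at hb ⊢
    refine ⟨x⁻¹ * b * x, ?_, by group⟩
    refine (Subgroup.mem_normalizer_iff.1 hx _).2 ?_
    have : x * (x⁻¹ * b * x) * x⁻¹ = b := by group
    rwa [this]
  · intro a _
    rw [← map_mul, ← map_mul]
    congr 1
    group

theorem hat_commute {L M : Subgroup G} (h : L ≤ Subgroup.normalizer (M : Set G)) :
    Commute (hat L) (hat M) := by
  classical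
  rw [hat]
  refine Commute.smul_left (Commute.sum_left _ _ _ fun x hx => ?_) _
  simp only [Finset.mem_filter, Finset.mem_univ, true_and] at hx
  exact commute_of_hat (h hx)

/-- `L` is minimal among the normal subgroups of `H` that contain `K` properly. -/
def IsMinNormalAbove (H K L : Subgroup G) : Prop :=
  Minimal (fun M : Subgroup G => NormalIn M H ∧ K < M) L

theorem IsMinNormalAbove.commute {H K L M : Subgroup G} (hL : IsMinNormalAbove H K L)
    (hM : IsMinNormalAbove H K M) : Commute (hat K - hat L) (hat K - hat M) := by
  have key : ∀ {X Y : Subgroup G}, X ≤ H → IsMinNormalAbove H K Y →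
      Commute (hat X) (hat Y) := by
    intro X Y hX hY
    have hn := hY.prop.1.2
    exact hat_commute (hX.trans ((Subgroup.normal_subgroupOf_iff_le_normalizer hY.prop.1.1).1 hn))
  have hK : K ≤ H := hL.prop.2.le.trans hL.prop.1.1
  exact ((Commute.refl _).sub_right (key hK hM)).sub_left
    ((key hK hL).symm.sub_right (key hL.prop.1.1 hM))

open Classical in
/-- `ε(H, K)`, for `K ⊴ H`: it is `K̂` if `H = K`, and otherwise the product of the (pairwise
commuting) elements `K̂ - L̂`, where `L` runs over the minimal normal subgroups of `H` that contain
`K` properly. -/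
noncomputable def eps (H K : Subgroup G) : MonoidAlgebra ℚ G :=
  if H = K then hat K
  else (Finset.univ.filter fun L : Subgroup G => IsMinNormalAbove H K L).noncommProd
    (fun L => hat K - hat L) fun _ hL _ hM _ =>
      (Finset.mem_filter.1 hL).2.commute (Finset.mem_filter.1 hM).2

/-- The conjugate `α^g = g⁻¹ α g` in `ℚG`. -/
noncomputable def conjBy (g : G) (α : MonoidAlgebra ℚ G) : MonoidAlgebra ℚ G :=
  MonoidAlgebra.of ℚ G g⁻¹ * α * MonoidAlgebra.of ℚ G g

/-- The subgroup `H / K` of `N_G(K) / K`, for `K ≤ H ≤ N_G(K)`. -/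
def quotientImage (H K : Subgroup G) :
    Subgroup (Subgroup.normalizer (K : Set G) ⧸ K.subgroupOf (Subgroup.normalizer (K : Set G))) :=
  (H.subgroupOf (Subgroup.normalizer (K : Set G))).map (QuotientGroup.mk' _)

/-- Strong Shoda pairs `(H, K)` of `G`. -/
structure IsStrongShodaPair (H K : Subgroup G) : Prop where
  normal_left : NormalIn K H
  normal_right : NormalIn H (Subgroup.normalizer (K : Set G))
  cyclic : IsCyclic (quotientImage H K)
  maximal_abelian : Maximal (fun B : Subgroup (Subgroup.normalizer (K : Set G) ⧸
    K.subgroupOf (Subgroup.normalizer (K : Set G))) => IsMulCommutative B) (quotientImage H K)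
  orthogonal : ∀ x y : G, conjBy x (eps H K) ≠ conjBy y (eps H K) →
    conjBy x (eps H K) * conjBy y (eps H K) = 0

end Idempotents

section Characters

variable {G : Type*} [Group G]

/-- The inertia group `I_G(φ)` of a linear character `φ` of a subgroup `B` of `G`: all `g ∈ G` such
that `φ ^ g = φ`, where `φ ^ g` is the character `x ↦ φ (g x g⁻¹)` of `g⁻¹ B g`. -/
def inertia {B : Subgroup G} (φ : B →* ℂˣ) : Subgroup G where
  carrier := {g | g ∈ Subgroup.normalizer (B : Set G) ∧
    ∀ x y : B, (y : G) = g * x * g⁻¹ → φ y = φ x}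
  one_mem' := ⟨one_mem _, fun x y h => by
    have : y = x := Subtype.ext (by simpa using h)
    rw [this]⟩
  mul_mem' := by
    rintro a b ⟨ha, ha'⟩ ⟨hb, hb'⟩
    refine ⟨mul_mem ha hb, fun x y h => ?_⟩
    have hz : b * x * b⁻¹ ∈ B := (Subgroup.mem_normalizer_iff.1 hb _).1 x.2
    rw [ha' ⟨_, hz⟩ y (by rw [h]; simp [mul_assoc]), hb' x ⟨_, hz⟩ rfl]
  inv_mem' := by
    rintro a ⟨ha, ha'⟩
    refine ⟨inv_mem ha, fun x y h => ?_⟩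
    exact (ha' y x (by rw [h]; simp [mul_assoc])).symm

/-- The field `ℚ(θ)` generated by the values of `θ`. -/
noncomputable def charField {A : Subgroup G} (θ : A →* ℂˣ) : IntermediateField ℚ ℂ :=
  IntermediateField.adjoin ℚ (Set.range fun a : A => (θ a : ℂ))

open Classical in
/-- The character of `G` induced by a linear character `θ` of a subgroup `A`. -/
noncomputable def indChar [Fintype G] {A : Subgroup G} (θ : A →* ℂˣ) : G → ℂ := fun g =>
  (Nat.card A : ℂ)⁻¹ * ∑ x : G, if h : x * g * x⁻¹ ∈ A then (θ ⟨x * g * x⁻¹, h⟩ : ℂ) else 0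

/-- The kernel `{g | χ g = χ 1}` of a character `χ` of `G`. -/
def charKer (χ : G → ℂ) : Set G := {g | χ g = χ 1}

end Characters

/-- The data `(H, A, θ)` of a triple: subgroups `H`, `A` of `G` and a linear character `θ`
of `A`. -/
structure Triple (G : Type*) [Group G] where
  H : Subgroup G
  A : Subgroup G
  θ : A →* ℂˣ

section Triples

variable {G : Type*} [Group G]

/-- The kernel of `θ`, as a subgroup of `G`. -/
def Triple.ker (T : Triple G) : Subgroup G := T.θ.ker.map T.A.subtype

/-- `(H, A, θ)` is an `N`-linear character triple of `G`: `A ⊴ H`, the linear character `θ` of `A`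
is invariant in `H`, and the kernel of the induced character `θ ^ G` is `N`. -/
structure Triple.IsLinearTriple [Fintype G] (N : Subgroup G) (T : Triple G) : Prop where
  normal : NormalIn T.A T.H
  invariant : T.H ≤ inertia T.θ
  ker_induced : charKer (indChar T.θ) = (N : Set G)

/-- `B` is a normal subgroup of `H` that contains `ker θ` and has `B / ker θ` abelian. -/
def Triple.IsAdmissible (T : Triple G) (B : Subgroup G) : Prop :=
  NormalIn B T.H ∧ AbelianQuotient B T.ker

/-- An admissible subgroup of maximal order. -/
def Triple.IsMaxAdmissible (T : Triple G) (B : Subgroup G) : Prop :=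
  T.IsAdmissible B ∧ ∀ B' : Subgroup G, T.IsAdmissible B' → Nat.card B' ≤ Nat.card B

/-- The set of linear characters `φ` of `B` that lie above `θ` (as `φ` is linear, this says that
its restriction to `A` is `θ`) and for which the kernel of `φ ^ G` is `N`. -/
def Triple.LinAbove [Fintype G] (N : Subgroup G) (T : Triple G) (B : Subgroup G) :
    Set (B →* ℂˣ) :=
  {φ | (∃ h : T.A ≤ B, φ.comp (Subgroup.inclusion h) = T.θ) ∧
    charKer (indChar φ) = (N : Set G)}

/-- `ψ = σ ∘ φ ^ h` for some `h ∈ H` and some automorphism `σ` of `ℂ` that fixes `ℚ(θ)`. -/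
def Triple.SameOrbit (T : Triple G) {B : Subgroup G} (φ ψ : B →* ℂˣ) : Prop :=
  ∃ σ : ℂ ≃ₐ[charField T.θ] ℂ, ∃ h ∈ T.H, ∀ b : B, ∃ hb : h * b * h⁻¹ ∈ B,
    (ψ b : ℂ) = σ (φ ⟨h * b * h⁻¹, hb⟩)

/-- The choices on which the construction depends: for every `N`-linear character triple
`T = (H, A, θ)` of `G`, a subgroup `𝒜 T` of maximal order among the normal subgroups of `H` that
contain `ker θ` and are abelian modulo `ker θ`, and a set of representatives of the
distinct orbits of the linear characters of `𝒜 T` above `θ` with induced kernel `N`. -/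
structure Choices (G : Type*) [Group G] [Fintype G] where
  𝒜 : Triple G → Subgroup G
  reps : ∀ T : Triple G, Set (𝒜 T →* ℂˣ)
  isMaxAdmissible : ∀ (N : Subgroup G) (T : Triple G), T.IsLinearTriple N →
    T.IsMaxAdmissible (𝒜 T)
  reps_subset : ∀ (N : Subgroup G) (T : Triple G), T.IsLinearTriple N →
    reps T ⊆ T.LinAbove N (𝒜 T)
  existsUnique_rep : ∀ (N : Subgroup G) (T : Triple G), T.IsLinearTriple N →
    ∀ ψ ∈ T.LinAbove N (𝒜 T), ∃! φ, φ ∈ reps T ∧ T.SameOrbit φ ψ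

variable [Fintype G]

/-- The set `Cl(H, A, θ)` of direct Clifford correspondents of `(H, A, θ)`. -/
def Choices.Cl (c : Choices G) (T : Triple G) : Set (Triple G) :=
  {T' | T.H ≠ T.A ∧ ∃ φ ∈ c.reps T, T' = ⟨T.H ⊓ inertia φ, c.𝒜 T, φ⟩}

/-- The triple `(G, N, 1_N)`. -/
def root (N : Subgroup G) : Triple G := ⟨⊤, N, 1⟩

/-- Edges of the directed graph whose vertices are the `N`-linear character triples of `G`. -/
def Choices.Edge (c : Choices G) (N : Subgroup G) (u v : Triple G) : Prop :=
  u.IsLinearTriple N ∧ v.IsLinearTriple N ∧ v ∈ c.Cl u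

/-- `l` lists the vertices of a directed path from `(G, N, 1_N)` to `v`. -/
structure Choices.IsPathTo (c : Choices G) (N : Subgroup G) (v : Triple G)
    (l : List (Triple G)) : Prop where
  head : l.head? = some (root N)
  last : l.getLast? = some v
  nodup : l.Nodup
  vertex : ∀ u ∈ l, u.IsLinearTriple N
  chain : l.IsChain (c.Edge N)

/-- The vertex set of `𝒢_N`. -/
def Choices.vertices (c : Choices G) (N : Subgroup G) : Set (Triple G) :=
  {v | ∃ l, c.IsPathTo N v l}

/-- `ℒ_N`: the leaves (sinks) of `𝒢_N` of the form `(H, H, θ)`. -/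
def Choices.leaves (c : Choices G) (N : Subgroup G) : Set (Triple G) :=
  {v | v ∈ c.vertices N ∧ (∀ w ∈ c.vertices N, ¬ c.Edge N v w) ∧ v.H = v.A}

/-- The vertex `v` has height `n`: the directed path from the root to `v` has `n` vertices. -/
def Choices.HasHeight (c : Choices G) (N : Subgroup G) (v : Triple G) (n : ℕ) : Prop :=
  ∃ l, c.IsPathTo N v l ∧ l.length = n

/-- `w` is the `i`-th node of `v` (counted from `1`, the root). -/
def Choices.IsNode (c : Choices G) (N : Subgroup G) (v : Triple G) (i : ℕ) (w : Triple G) :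
    Prop :=
  ∃ l, c.IsPathTo N v l ∧ 1 ≤ i ∧ l[i - 1]? = some w

end Triples

end ShodaTriples

open ShodaTriples

namespace ShodaTriples

/-! ### Averaging elements of `ℚG` and the conjugates of `ε(H, K)` -/

section Idempotents

variable {G : Type*} [Group G]

/-! Let `K = ker θ` for the linear character `θ` of `H`, and `ε = ε(H, K)`. Since `H / K` is
abelian, `ε` absorbs `L̂` for `L ≤ K` and annihilates `L̂` for `L ≤ H` not inside `K`. So `ε` is
orthogonal to `ε^g` as soon as some `L ≤ K` has `L^g` inside `H` but not inside `K`
(`eps_mul_conjBy_eps_eq_zero`).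

The subgroup `A` of the second node is normal in `G`, and its character is `θ` restricted to `A`,
with kernel `A ⊓ K`. If `g` does not normalize `A ⊓ K`, then `L = A ⊓ K` works. If it does, `g`
normalizes `H` by hypothesis, and either `L = K` works or `g` normalizes `K` and fixes `ε`.

For maximality, an element centralizing `H / K` fixes `θ`, hence all its restrictions along the
path, so it lies in every inertia group and finally in `H`. -/

theorem normalIn_of_commutator_le {H K M : Subgroup G} (hc : ⁅H, H⁆ ≤ K) (hKM : K ≤ M)
    (hMH : M ≤ H) : NormalIn M H := by
  refine ⟨hMH, ⟨fun m hm h => ?_⟩⟩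
  rw [Subgroup.mem_subgroupOf] at hm ⊢
  have := M.mul_mem (hKM (hc (Subgroup.commutator_mem_commutator h.2 m.2))) hm
  simpa [commutatorElement_def] using this

theorem le_normalizer_of_commutator_le {H K M : Subgroup G} (hc : ⁅H, H⁆ ≤ K) (hKM : K ≤ M)
    (hMH : M ≤ H) : H ≤ Subgroup.normalizer (M : Set G) :=
  (Subgroup.normal_subgroupOf_iff_le_normalizer hMH).1
    (normalIn_of_commutator_le hc hKM hMH).2

theorem conjBy_mul (g : G) (a b : MonoidAlgebra ℚ G) :
    conjBy g (a * b) = conjBy g a * conjBy g b := by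
  have h : MonoidAlgebra.of ℚ G g * MonoidAlgebra.of ℚ G g⁻¹ = 1 := by
    rw [← map_mul, mul_inv_cancel, map_one]
  unfold conjBy
  calc _ = MonoidAlgebra.of ℚ G g⁻¹ * a * 1 * b * MonoidAlgebra.of ℚ G g := by
        rw [mul_one]; simp only [mul_assoc]
    _ = _ := by rw [← h]; simp only [mul_assoc]

theorem conjBy_one (g : G) : conjBy g 1 = 1 := by
  rw [conjBy, mul_one, ← map_mul, inv_mul_cancel, map_one]

theorem conjBy_sub (g : G) (a b : MonoidAlgebra ℚ G) :
    conjBy g (a - b) = conjBy g a - conjBy g b := by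
  rw [conjBy, mul_sub, sub_mul]; rfl

theorem conjBy_zero (g : G) : conjBy g 0 = 0 := by
  rw [conjBy, mul_zero, zero_mul]

theorem conjBy_conjBy (g h : G) (a : MonoidAlgebra ℚ G) :
    conjBy g (conjBy h a) = conjBy (h * g) a := by
  simp only [conjBy, mul_inv_rev, map_mul, mul_assoc]

theorem conjBy_one_left (a : MonoidAlgebra ℚ G) : conjBy 1 a = a := by
  rw [conjBy, inv_one, map_one, one_mul, mul_one]

/-- The conjugate `L ^ g = g⁻¹ L g`. -/
def conjSubgroup (g : G) (L : Subgroup G) : Subgroup G := L.map (MulAut.conj g⁻¹).toMonoidHom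

theorem mem_conjSubgroup {g x : G} {L : Subgroup G} : x ∈ conjSubgroup g L ↔ g * x * g⁻¹ ∈ L := by
  constructor
  · rintro ⟨y, hy, rfl⟩
    simpa [mul_assoc] using hy
  · exact fun h => ⟨_, h, by simp [mul_assoc]⟩

theorem card_conjSubgroup (g : G) (L : Subgroup G) : Nat.card (conjSubgroup g L) = Nat.card L :=
  Subgroup.card_map_of_injective (MulAut.conj g⁻¹).injective

theorem conjSubgroup_eq_self_iff {g : G} {L : Subgroup G} :
    conjSubgroup g L = L ↔ g ∈ Subgroup.normalizer (L : Set G) := by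
  rw [Subgroup.mem_normalizer_iff, SetLike.ext_iff]
  simp only [mem_conjSubgroup]
  exact forall_congr' fun _ => Iff.comm

variable [Fintype G]

theorem of_mul_hat {L : Subgroup G} {x : G} (hx : x ∈ L) :
    MonoidAlgebra.of ℚ G x * hat L = hat L := by
  classical
  unfold hat
  rw [mul_smul_comm, Finset.mul_sum]
  congr 1
  refine Finset.sum_bij (fun h _ => x * h) ?_ ?_ ?_ ?_
  · intro h hh
    simp only [Finset.mem_filter, Finset.mem_univ, true_and] at hh ⊢
    exact L.mul_mem hx hh
  · intro a _ b _ hab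
    simpa using hab
  · intro b hb
    simp only [Finset.mem_filter, Finset.mem_univ, true_and] at hb ⊢
    exact ⟨x⁻¹ * b, L.mul_mem (L.inv_mem hx) hb, by group⟩
  · intro a _
    rw [← map_mul]

/-- The average over `L` of a constant is that constant. -/
theorem mul_hat_mul_eq {L : Subgroup G} {a b c : MonoidAlgebra ℚ G}
    (h : ∀ x ∈ L, a * MonoidAlgebra.of ℚ G x * b = c) : a * hat L * b = c := by
  classical
  unfold hat
  rw [mul_smul_comm, smul_mul_assoc, Finset.mul_sum, Finset.sum_mul,
    Finset.sum_congr rfl fun x hx => h x (by simpa using hx), Finset.sum_const,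
    ← Nat.cast_smul_eq_nsmul ℚ, smul_smul]
  have : (Finset.univ.filter fun x => x ∈ L).card = Nat.card L := by
    rw [Nat.card_eq_fintype_card, Fintype.card_subtype]
  rw [this, inv_mul_cancel₀ (Nat.cast_ne_zero.2 Nat.card_pos.ne'), one_smul]

theorem hat_mul_hat_of_le {L M : Subgroup G} (h : L ≤ M) : hat L * hat M = hat M := by
  have := mul_hat_mul_eq (L := L) (a := 1) (b := hat M) (c := hat M) fun x hx => by
    rw [one_mul, of_mul_hat (h hx)]
  rwa [one_mul] at this

theorem hat_mul_hat_of_ge {L M : Subgroup G} (h : L ≤ M) : hat M * hat L = hat M := by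
  rw [← (hat_commute (h.trans Subgroup.le_normalizer)).eq, hat_mul_hat_of_le h]

/-- If every element of `M` lies in `K L`, then `M̂` and `K̂` agree on `L̂`. -/
theorem hat_mul_hat_eq {K L M : Subgroup G} (hKM : K ≤ M)
    (hLK : L ≤ Subgroup.normalizer (K : Set G)) (hM : M ≤ K ⊔ L) :
    hat M * hat L = hat K * hat L := by
  rw [← hat_mul_hat_of_le hKM]
  refine mul_hat_mul_eq fun m hm => ?_
  have hm' : m ∈ L ⊔ K := sup_comm K L ▸ hM hm
  rw [← SetLike.mem_coe, Subgroup.coe_mul_of_left_le_normalizer_right _ _ hLK] at hm'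
  obtain ⟨l, hl, k, hk, rfl⟩ := hm'
  -- With `m = l k`: move `l` left past `K̂`, absorb `k` into `K̂`, move `l` back and absorb it into
  -- `L̂`.
  have h1 := (commute_of_hat (hLK hl)).eq
  simp only [map_mul]
  rw [← mul_assoc, ← h1, mul_assoc _ (hat K), (commute_of_hat (Subgroup.le_normalizer hk)).symm.eq,
    of_mul_hat hk, h1, mul_assoc, of_mul_hat hl]

theorem exists_isMinNormalAbove {H K M : Subgroup G} (hc : ⁅H, H⁆ ≤ K) (hKM : K < M)
    (hMH : M ≤ H) : ∃ L ≤ M, IsMinNormalAbove H K L := by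
  obtain ⟨L, hL, hmin⟩ := exists_minimal_le_of_wellFoundedLT
    (fun M : Subgroup G => NormalIn M H ∧ K < M) M
    ⟨normalIn_of_commutator_le hc hKM.le hMH, hKM⟩
  exact ⟨L, hL, hmin⟩

theorem hat_commute_eps {H K L : Subgroup G} (hc : ⁅H, H⁆ ≤ K) (hKH : K ≤ H) (hL : L ≤ H) :
    Commute (hat L) (eps H K) := by
  have hK : Commute (hat L) (hat K) :=
    hat_commute (hL.trans (le_normalizer_of_commutator_le hc le_rfl hKH))
  classical
  unfold eps
  split_ifs with h
  · exact hK
  · refine Finset.noncommProd_commute _ _ _ _ fun M hM => hK.sub_right (hat_commute ?_)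
    have hM := (Finset.mem_filter.1 hM).2.prop
    exact hL.trans (le_normalizer_of_commutator_le hc hM.2.le hM.1.1)

theorem exists_eps_eq_mul {H K L : Subgroup G} (h : H ≠ K) (hL : IsMinNormalAbove H K L) :
    ∃ a, eps H K = a * (hat K - hat L) := by
  classical
  unfold eps
  rw [if_neg h]
  exact ⟨_, (Finset.noncommProd_erase_mul _ (a := L) (by simpa using hL) _ _).symm⟩

theorem eps_mul_hat_self {H K : Subgroup G} (hc : ⁅H, H⁆ ≤ K) (hKH : K ≤ H) :
    eps H K * hat K = eps H K := by
  by_cases h : H = K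
  · rw [eps, if_pos h, hat_mul_hat_of_le le_rfl]
  · obtain ⟨L, -, hL⟩ := exists_isMinNormalAbove hc (lt_of_le_of_ne hKH (Ne.symm h)) le_rfl
    obtain ⟨a, ha⟩ := exists_eps_eq_mul h hL
    rw [ha, mul_assoc, sub_mul, hat_mul_hat_of_le le_rfl, hat_mul_hat_of_ge hL.prop.2.le]

/-- Some minimal `M` lies between `K` and `K L`. Then `M̂ L̂ = K̂ L̂`, so the factor `K̂ - M̂` of
`ε` already annihilates `L̂`. -/
theorem eps_mul_hat_eq_zero {H K L : Subgroup G} (hc : ⁅H, H⁆ ≤ K) (hKH : K ≤ H) (hL : L ≤ H)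
    (hLK : ¬ L ≤ K) : eps H K * hat L = 0 := by
  have h : H ≠ K := by rintro rfl; exact hLK hL
  obtain ⟨M, hML, hM⟩ := exists_isMinNormalAbove hc (left_lt_sup.2 hLK) (sup_le hKH hL)
  obtain ⟨a, ha⟩ := exists_eps_eq_mul h hM
  rw [ha, mul_assoc, sub_mul, hat_mul_hat_eq hM.prop.2.le
    (hL.trans (le_normalizer_of_commutator_le hc le_rfl hKH)) hML, sub_self, mul_zero]

theorem conjSubgroup_eq_self_of_le {g : G} {L : Subgroup G} (h : conjSubgroup g L ≤ L) :
    conjSubgroup g L = L :=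
  Subgroup.eq_of_le_of_card_ge h (card_conjSubgroup g L).ge

theorem conjBy_hat (g : G) (L : Subgroup G) : conjBy g (hat L) = hat (conjSubgroup g L) := by
  classical
  unfold conjBy
  rw [hat, hat, mul_smul_comm, smul_mul_assoc, card_conjSubgroup, Finset.mul_sum, Finset.sum_mul]
  congr 1
  refine Finset.sum_bij (fun h _ => g⁻¹ * h * g) ?_ ?_ ?_ ?_
  · intro h hh
    simp only [Finset.mem_filter, Finset.mem_univ, true_and, mem_conjSubgroup] at hh ⊢
    simpa [mul_assoc] using hh
  · intro a _ b _ hab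
    simpa using hab
  · intro b hb
    simp only [Finset.mem_filter, Finset.mem_univ, true_and, mem_conjSubgroup] at hb ⊢
    exact ⟨_, hb, by group⟩
  · intro a _
    rw [map_mul, map_mul]

/-- Conjugation by an element normalizing `H` and `K` fixes `ε(H, K)`. -/
theorem conjBy_eps {H K : Subgroup G} (hc : ⁅H, H⁆ ≤ K) (hKH : K ≤ H) {g : G}
    (hgH : g ∈ Subgroup.normalizer (H : Set G)) (hgK : g ∈ Subgroup.normalizer (K : Set G)) :
    conjBy g (eps H K) = eps H K := by
  classical
  have hK : ∀ {x : G}, x ∈ Subgroup.normalizer (K : Set G) → conjBy x (hat K) = hat K :=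
    fun hx => by rw [conjBy_hat, conjSubgroup_eq_self_iff.2 hx]
  by_cases h : H = K
  · rw [eps, if_pos h, hK hgK]
  have key : ∀ x ∈ Subgroup.normalizer (H : Set G), x ∈ Subgroup.normalizer (K : Set G) →
      ∀ L, IsMinNormalAbove H K L → eps H K * conjBy x (hat K - hat L) = eps H K ∧
        conjBy x (hat K - hat L) * eps H K = eps H K := by
    intro x hxH hxK L hL
    have hLH : conjSubgroup x L ≤ H := by
      intro y hy
      rw [mem_conjSubgroup] at hy
      exact (Subgroup.mem_normalizer_iff.1 hxH y).2 (hL.prop.1.1 hy)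
    have hLK : ¬ conjSubgroup x L ≤ K := by
      intro hle
      refine hL.prop.2.not_ge fun y hy => ?_
      have : x⁻¹ * y * x ∈ K := hle (mem_conjSubgroup.2 (by simpa [mul_assoc] using hy))
      simpa [mul_assoc] using (Subgroup.mem_normalizer_iff.1 hxK _).1 this
    rw [conjBy_sub, hK hxK, conjBy_hat, mul_sub, sub_mul, (hat_commute_eps hc hKH hKH).eq,
      (hat_commute_eps hc hKH hLH).eq, eps_mul_hat_self hc hKH,
      eps_mul_hat_eq_zero hc hKH hLH hLK, sub_zero]
    exact ⟨rfl, rfl⟩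
  -- No reindexing of the product is needed: `ε` absorbs every conjugated factor on either side.
  -- Hence `ε ε^g = ε` and `ε^(g⁻¹) ε = ε`; conjugating the former by `g⁻¹` gives `ε^(g⁻¹) = ε`.
  have left : eps H K * conjBy g (eps H K) = eps H K := by
    nth_rw 2 [eps]
    rw [if_neg h]
    refine Finset.noncommProd_induction _ _ _ (fun y => eps H K * conjBy g y = eps H K)
      (fun a b ha hb => ?_) ?_ fun L hL => (key g hgH hgK L (Finset.mem_filter.1 hL).2).1
    · rw [conjBy_mul, ← mul_assoc, ha, hb]
    · rw [conjBy_one, mul_one]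
  have right : conjBy g⁻¹ (eps H K) = conjBy g⁻¹ (eps H K) * eps H K := by
    have := congrArg (conjBy g⁻¹) left
    rw [conjBy_mul, conjBy_conjBy, mul_inv_cancel, conjBy_one_left] at this
    exact this.symm
  have right' : conjBy g⁻¹ (eps H K) * eps H K = eps H K := by
    nth_rw 1 [eps]
    rw [if_neg h]
    refine Finset.noncommProd_induction _ _ _ (fun y => conjBy g⁻¹ y * eps H K = eps H K)
      (fun a b ha hb => ?_) ?_ fun L hL => (key g⁻¹ (inv_mem hgH) (inv_mem hgK) L
        (Finset.mem_filter.1 hL).2).2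
    · rw [conjBy_mul, mul_assoc, hb, ha]
    · rw [conjBy_one, one_mul]
  have := congrArg (conjBy g) (right.trans right')
  rw [conjBy_conjBy, inv_mul_cancel, conjBy_one_left] at this
  exact this.symm

/-- If some conjugate `L ^ g` with `L ≤ K` lies in `H` but not in `K`, then `ε(H, K)` and its
conjugate by `g` are orthogonal. -/
theorem eps_mul_conjBy_eps_eq_zero {H K L : Subgroup G} (hc : ⁅H, H⁆ ≤ K) (hKH : K ≤ H) {g : G}
    (hLK : L ≤ K) (hH : conjSubgroup g L ≤ H) (hK : ¬ conjSubgroup g L ≤ K) :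
    eps H K * conjBy g (eps H K) = 0 := by
  have h1 : eps H K = hat L * eps H K := by
    rw [(hat_commute_eps hc hKH (hLK.trans hKH)).eq]
    nth_rw 2 [← eps_mul_hat_self hc hKH]
    rw [mul_assoc, hat_mul_hat_of_ge hLK, eps_mul_hat_self hc hKH]
  -- `ε^g` carries the left factor `hat (L^g)`, which `ε` annihilates.
  rw [h1, conjBy_mul, conjBy_hat, ← mul_assoc, ← h1, eps_mul_hat_eq_zero hc hKH hH hK, zero_mul]

end Idempotents

/-! ### Shoda pairs from the kernel of a linear character -/

section LinearCharacters

variable {G : Type*} [Group G] {H : Subgroup G} (θ : H →* ℂˣ)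

theorem mem_map_ker {x : G} : x ∈ θ.ker.map H.subtype ↔ ∃ h : x ∈ H, θ ⟨x, h⟩ = 1 := by
  simp [Subgroup.mem_map, MonoidHom.mem_ker]

theorem commutator_le_map_ker : ⁅H, H⁆ ≤ θ.ker.map H.subtype := by
  rw [Subgroup.commutator_le]
  intro a ha b hb
  refine ⟨⟨a, ha⟩ * ⟨b, hb⟩ * ⟨a, ha⟩⁻¹ * ⟨b, hb⟩⁻¹, ?_, rfl⟩
  rw [SetLike.mem_coe, MonoidHom.mem_ker, map_mul, map_mul, map_mul, map_inv, map_inv,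
    mul_right_comm (θ _), mul_inv_cancel, one_mul, mul_inv_cancel]

theorem Triple.ker_eq_inf {u v : Triple G} (hA : u.A ≤ v.A)
    (hA' : ∀ a : u.A, v.θ (Subgroup.inclusion hA a) = u.θ a) : u.ker = u.A ⊓ v.ker := by
  ext x
  rw [Subgroup.mem_inf, Triple.ker, Triple.ker, mem_map_ker, mem_map_ker]
  constructor
  · rintro ⟨h, hx⟩
    exact ⟨h, hA h, (hA' ⟨x, h⟩).trans hx⟩
  · rintro ⟨h, _, hx⟩
    exact ⟨h, (hA' ⟨x, h⟩).symm.trans hx⟩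

variable [Fintype G]

theorem isCyclic_quotientImage
    (hHN : H ≤ Subgroup.normalizer ((θ.ker.map H.subtype : Subgroup G) : Set G)) :
    IsCyclic (quotientImage H (θ.ker.map H.subtype)) := by
  set K := θ.ker.map H.subtype with hK
  have : Finite θ.range := Set.finite_range θ
  -- A finite subgroup of `ℂˣ` is cyclic; a preimage of its generator generates `H` modulo `K`.
  obtain ⟨⟨_, h₀, rfl⟩, hgen⟩ := IsCyclic.exists_generator (α := θ.range)
  let n₀ : Subgroup.normalizer (K : Set G) := ⟨h₀, hHN h₀.2⟩
  refine ⟨⟨⟨QuotientGroup.mk' _ n₀, n₀, h₀.2, rfl⟩, ?_⟩⟩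
  rintro ⟨_, n, hn, rfl⟩
  obtain ⟨k, hk⟩ := hgen ⟨_, ⟨n, hn⟩, rfl⟩
  refine ⟨k, Subtype.ext ?_⟩
  have hk : θ h₀ ^ k = θ ⟨n, hn⟩ := by simpa using congrArg Subtype.val hk
  change QuotientGroup.mk' (K.subgroupOf _) n₀ ^ k = QuotientGroup.mk' (K.subgroupOf _) n
  rw [← map_zpow, QuotientGroup.mk'_eq_mk']
  refine ⟨(n₀ ^ k)⁻¹ * n, ?_, by group⟩
  rw [Subgroup.mem_subgroupOf]
  refine ⟨(h₀ ^ k)⁻¹ * ⟨n, hn⟩, ?_, rfl⟩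
  rw [SetLike.mem_coe, MonoidHom.mem_ker, map_mul, map_inv, map_zpow, hk, inv_mul_cancel]

/-- `H / ker θ` is maximal abelian in `N_G(ker θ) / ker θ` if only the elements of `H` stabilize
`θ` on intersections of `H` with its conjugates. -/
theorem maximal_quotientImage
    (hHN : H ≤ Subgroup.normalizer ((θ.ker.map H.subtype : Subgroup G) : Set G))
    (hθ : ∀ g : G, (∀ x y : H, (y : G) = g * x * g⁻¹ → θ y = θ x) → g ∈ H) :
    Maximal (fun B : Subgroup (Subgroup.normalizer ((θ.ker.map H.subtype : Subgroup G) : Set G) ⧸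
      (θ.ker.map H.subtype).subgroupOf (Subgroup.normalizer
        ((θ.ker.map H.subtype : Subgroup G) : Set G))) => IsMulCommutative B)
      (quotientImage H (θ.ker.map H.subtype)) := by
  set K := θ.ker.map H.subtype with hK
  refine ⟨?_, fun B hB hle b hb => ?_⟩
  · have := isCyclic_quotientImage θ hHN
    exact ⟨⟨(IsCyclic.commGroup (α := quotientImage H K)).mul_comm⟩⟩
  · obtain ⟨n, rfl⟩ := QuotientGroup.mk'_surjective _ b
    refine ⟨n, hθ n fun x y hxy => ?_, rfl⟩
    have hx : QuotientGroup.mk' (K.subgroupOf (Subgroup.normalizer (K : Set G)))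
        ⟨x, hHN x.2⟩ ∈ B := hle ⟨_, x.2, rfl⟩
    -- As `B` is abelian and contains `H / K`, `n` moves each `x` of `H` only within `x K`, where
    -- `θ` is constant.
    have hcomm := congrArg Subtype.val (hB.is_comm.comm ⟨_, hx⟩ ⟨_, hb⟩)
    change QuotientGroup.mk' _ _ * QuotientGroup.mk' _ _ =
      QuotientGroup.mk' _ _ * QuotientGroup.mk' _ _ at hcomm
    rw [← map_mul, ← map_mul, QuotientGroup.mk'_eq_mk'] at hcomm
    obtain ⟨z, hz, hz'⟩ := hcomm
    rw [Subgroup.mem_subgroupOf] at hz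
    have hz' := congrArg Subtype.val hz'
    simp only [Subgroup.coe_mul] at hz'
    have hzK : (n : G) * z * (n : G)⁻¹ ∈ K := (Subgroup.mem_normalizer_iff.1 n.2 _).1 hz
    obtain ⟨hzH, hz1⟩ := (mem_map_ker θ).1 hzK
    have : x * ⟨_, hzH⟩ = y := by
      apply Subtype.ext
      rw [hxy, Subgroup.coe_mul, ← hz']
      group
    rw [← this, map_mul, hz1, mul_one]

/-- `A` plays the role of the second node's subgroup, so that `A ⊓ ker θ` is the kernel of the
second node's character. -/
theorem isStrongShodaPair_map_ker {A : Subgroup G} [hA : A.Normal] (hAH : A ≤ H)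
    (hn : NormalIn H (Subgroup.normalizer ((A ⊓ θ.ker.map H.subtype : Subgroup G) : Set G)))
    (hθ : ∀ g : G, (∀ x y : H, (y : G) = g * x * g⁻¹ → θ y = θ x) → g ∈ H) :
    IsStrongShodaPair H (θ.ker.map H.subtype) := by
  have hc := commutator_le_map_ker θ
  have hHmax := fun hHN => maximal_quotientImage θ hHN hθ
  have hcyc := isCyclic_quotientImage θ
  have hKH : θ.ker.map H.subtype ≤ H := Subgroup.map_subtype_le _
  set K := θ.ker.map H.subtype with hK
  have hHN := le_normalizer_of_commutator_le hc le_rfl hKH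
  have hnorm : Subgroup.normalizer ((A ⊓ K : Subgroup G) : Set G) ≤
      Subgroup.normalizer (H : Set G) :=
    (Subgroup.normal_subgroupOf_iff_le_normalizer hn.1).1 hn.2
  have hKN : Subgroup.normalizer (K : Set G) ≤
      Subgroup.normalizer ((A ⊓ K : Subgroup G) : Set G) := by
    intro g hg
    rw [Subgroup.mem_normalizer_iff] at hg ⊢
    intro x
    rw [Subgroup.mem_inf, Subgroup.mem_inf, hg x, hA.mem_comm_iff, ← mul_assoc, inv_mul_cancel,
      one_mul]
  refine ⟨normalIn_of_commutator_le hc le_rfl hKH, ⟨hHN,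
    (Subgroup.normal_subgroupOf_iff_le_normalizer hHN).2 (hKN.trans hnorm)⟩, hcyc hHN,
    hHmax hHN, ?_⟩
  -- Conjugating by `x⁻¹` reduces any pair of conjugates to one containing `ε` itself.
  suffices h : ∀ g : G, conjBy g (eps H K) ≠ eps H K → eps H K * conjBy g (eps H K) = 0 by
    intro x y hxy
    have hy : conjBy y (eps H K) = conjBy x (conjBy (y * x⁻¹) (eps H K)) := by
      rw [conjBy_conjBy, inv_mul_cancel_right]
    rw [hy] at hxy ⊢
    rw [← conjBy_mul, h _ fun h => hxy (by rw [h]), conjBy_zero]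
  intro g hg
  by_cases hg₂ : g ∈ Subgroup.normalizer ((A ⊓ K : Subgroup G) : Set G)
  · have hgH := hnorm hg₂
    refine eps_mul_conjBy_eps_eq_zero hc hKH le_rfl (fun y hy => ?_) fun hle => ?_
    · exact (Subgroup.mem_normalizer_iff.1 hgH y).2 (hKH (mem_conjSubgroup.1 hy))
    · exact hg (conjBy_eps hc hKH hgH
        (conjSubgroup_eq_self_iff.1 (conjSubgroup_eq_self_of_le hle)))
  -- Normality of `A` keeps the conjugate inside `A ≤ H`; were it also inside `K`, equal orders
  -- would make `g` normalize `A ⊓ K`.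
  · have hle : conjSubgroup g (A ⊓ K) ≤ A := fun y hy => by
      have := hA.conj_mem _ (mem_conjSubgroup.1 hy).1 g⁻¹
      simpa [mul_assoc] using this
    refine eps_mul_conjBy_eps_eq_zero hc hKH inf_le_right (hle.trans hAH) fun hle' => ?_
    exact hg₂ (conjSubgroup_eq_self_iff.1 (conjSubgroup_eq_self_of_le (le_inf hle hle')))

end LinearCharacters

/-! ### Paths of Clifford correspondents -/

section Paths

variable {G : Type*} [Group G] [Fintype G] {c : Choices G} {N : Subgroup G} {u v T : Triple G}

theorem Choices.Edge.exists_extension (h : c.Edge N u v) :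
    ∃ hA : u.A ≤ v.A, ∀ a : u.A, v.θ (Subgroup.inclusion hA a) = u.θ a := by
  obtain ⟨hu, -, -, φ, hφ, rfl⟩ := h
  obtain ⟨⟨hA, hres⟩, -⟩ := c.reps_subset N u hu hφ
  exact ⟨hA, fun a => DFunLike.congr_fun hres a⟩

theorem exists_extension_of_reflTransGen (h : Relation.ReflTransGen (c.Edge N) u v) :
    ∃ hA : u.A ≤ v.A, ∀ a : u.A, v.θ (Subgroup.inclusion hA a) = u.θ a := by
  induction h with
  | refl => exact ⟨le_rfl, fun _ => rfl⟩
  | tail _ hvw ih =>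
    obtain ⟨h₁, h₁'⟩ := ih
    obtain ⟨h₂, h₂'⟩ := hvw.exists_extension
    exact ⟨h₁.trans h₂, fun a => (h₂' _).trans (h₁' a)⟩

theorem Choices.Edge.normalIn (h : c.Edge N u v) : NormalIn v.A u.H := by
  obtain ⟨hu, -, -, φ, -, rfl⟩ := h
  exact (c.isMaxAdmissible N u hu).1.1

theorem Choices.Edge.mem_of_mem_inertia (h : c.Edge N u v) {g : G} (hg : g ∈ u.H)
    (hg' : g ∈ inertia v.θ) : g ∈ v.H := by
  obtain ⟨-, -, -, φ, -, rfl⟩ := h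
  exact ⟨hg, hg'⟩

/-- An element that stabilizes the linear character at the end of a path as far as it can be
conjugated lies in all the inertia groups along the path. -/
theorem mem_of_reflTransGen (h : Relation.ReflTransGen (c.Edge N) u T) {g : G}
    (hθ : ∀ x y : T.A, (y : G) = g * x * g⁻¹ → T.θ y = T.θ x) (hg : g ∈ u.H) : g ∈ T.H := by
  induction h using Relation.ReflTransGen.head_induction_on with
  | refl => exact hg
  | head huv hvT ih =>
    -- `u.H` normalizes `v.A`, and `v.θ` is a restriction of `T.θ`, so `g` lies in the inertia group
    -- of `v.θ`.
    refine ih (huv.mem_of_mem_inertia hg ⟨?_, fun x y hxy => ?_⟩)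
    · exact (Subgroup.normal_subgroupOf_iff_le_normalizer huv.normalIn.1).1 huv.normalIn.2 hg
    · obtain ⟨hA, hA'⟩ := exists_extension_of_reflTransGen hvT
      rw [← hA' x, ← hA' y]
      exact hθ _ _ hxy

theorem Choices.Edge.normal_of_root (h : c.Edge N (root N) v) : v.A.Normal := by
  refine Subgroup.normalizer_eq_top_iff.1 (top_le_iff.1 ?_)
  exact (Subgroup.normal_subgroupOf_iff_le_normalizer h.normalIn.1).1 h.normalIn.2

theorem Choices.IsNode.two (h : c.IsNode N T 2 v) :
    c.Edge N (root N) v ∧ Relation.ReflTransGen (c.Edge N) v T := by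
  obtain ⟨l, hl, -, hv⟩ := h
  match l, hl, hv with
  | a :: b :: l, hl, hv =>
    obtain rfl : a = root N := by simpa using hl.head
    obtain rfl : b = v := by simpa using hv
    have hc := List.isChain_cons_cons.1 hl.chain
    refine ⟨hc.1, List.relationReflTransGen_of_exists_isChain_cons l hc.2 ?_⟩
    have := hl.last
    rw [List.getLast?_cons_cons, List.getLast?_eq_getLast_of_ne_nil (List.cons_ne_nil _ _)] at this
    exact Option.some.inj this

theorem Choices.HasHeight.isNode_two (h : c.HasHeight N T 2) : c.IsNode N T 2 T := by
  obtain ⟨l, hl, h2⟩ := h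
  refine ⟨l, hl, by norm_num, ?_⟩
  have := hl.last
  -- In a list of length two, index `1` is both the last entry and the second node.
  rwa [List.getLast?_eq_getElem?, h2] at this

theorem isStrongShodaPair_of_isNode_two (hTA : T.H = T.A) (hv : c.IsNode N T 2 v)
    (hn : NormalIn T.H (Subgroup.normalizer (v.ker : Set G))) : IsStrongShodaPair T.H T.ker := by
  obtain ⟨hedge, hpath⟩ := hv.two
  obtain ⟨hA, hA'⟩ := exists_extension_of_reflTransGen hpath
  have := hedge.normal_of_root
  -- The path starts at the root, whose group is all of `G`, so no restriction on `g` remains.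
  have hmem := fun g hθ => mem_of_reflTransGen (g := g) (.head hedge hpath) hθ (Subgroup.mem_top g)
  rw [Triple.ker_eq_inf hA hA', hTA] at hn
  rw [hTA] at hmem ⊢
  exact isStrongShodaPair_map_ker T.θ hA hn hmem

end Paths

end ShodaTriples

open ShodaTriples
theorem corollary5p5 {G : Type*} [Group G] [Fintype G] (hG : InClassC G)
    (c : Choices G) (N : Subgroup G) [N.Normal] (T : Triple G) (hT : T ∈ c.leaves N) :
    (∀ T₂ : Triple G, c.IsNode N T 2 T₂ →
      NormalIn T.H (Subgroup.normalizer (T₂.ker : Set G)) → IsStrongShodaPair T.H T.ker) ∧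
    (c.HasHeight N T 2 → IsStrongShodaPair T.H T.ker) := by
  have hTA : T.H = T.A := hT.2.2
  refine ⟨fun T₂ hT₂ hn => isStrongShodaPair_of_isNode_two hTA hT₂ hn, fun h => ?_⟩
  have hnode := h.isNode_two
  -- At height two the leaf is its own second node, so `H` is normal in `G` and only `H ≤ N_G(ker
  -- θ)` is left.
  have hnormal : T.H.Normal := hTA ▸ hnode.two.1.normal_of_root
  refine isStrongShodaPair_of_isNode_two hTA hnode ⟨?_, hnormal.subgroupOf _⟩
  rw [hTA]
  exact le_normalizer_of_commutator_le (commutator_le_map_ker T.θ) le_rfl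
    (Subgroup.map_subtype_le _)
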